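/- Conventions. Let $A$ be a finite alphabet and $\pi:A^*\to G$ a surjective monoid homomorphism onto a group $G$. For $u\in A^*$ and $n\in\mathbb N$, $u^{[n]}$ denotes the prefix of $u$ of length $n$ (and $u^{[n]}=u$ if $n>|u|$), and $d_A$ is the path metric of the Cayley graph of $G$ with respect to $A\pi$. Maps are written on the right. For finite alphabets $A,B$ and a symbol $\$\notin A\cup B$, the convolution $u\diamond v$ of $u\in A^*$ and $v\in B^*$ is the unique word over $(A\times B)\cup(A\times\{\$\})\cup(\{\$\}\times B)$ whose projection on the first (second) component lies in $u\$^*$ (in $v\$^*$), and $K\diamond L=\{u\diamond v\mid u\in K,\ v\in L\}$. A regular language $L\subseteq A^*$ with $L\pi=G$ is an automatic structure for $\pi$ if for every $x\in A\cup\{1\}$ the language $\{u\diamond v\mid u,v\in L,\ v\pi=(ux)\pi\}$ is regular; a group is automatic if it has an automatic structure over some finite alphabet. Automatic structures $L_1$ for $\pi_1:A^*\to G$ and $L_2$ for $\pi_2:B^*\to G$ are synchronously equivalent if $L_1\cup L_2$ is an automatic structure for the homomorphism $(A\sqcup B)^*\to G$ induced by $\pi_1$ and $\pi_2$. For an endomorphism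 $\varphi$ of $G$, the synchronous BRP (bounded reduction property) holds for $(\varphi,L_1,L_2)$ if there is $N>0$ with $$d_B\big((x\,(\alpha^{[n]}\pi_1))\varphi,\ (x\varphi)(\beta^{[n]}\pi_2)\big)\le N$$ for all $n\in\mathbb N$, $x\in G$, $\alpha\in L_1$ and $\beta\in L_2$ with $\beta\pi_2=\alpha\pi_1\varphi$. For a language $L\subseteq A^*$, a subgroup $H\le G$ is $L$-quasiconvex (with respect to $\pi$) if there is $N$ such that $d_A(h(w^{[n]}\pi),H)\le N$ for all $h,h'\in H$, $w\in L$ with $h(w\pi)=h'$, and $n\in\mathbb N$. Statement. Let $G$ be a group with synchronously equivalent automatic structures $L_1$ for $\pi_1:A^*\to G$ and $L_2$ for $\pi_2:B^*\to G$, where $A$ and $B$ are finite alphabets, and let $\varphi:G\to G$ be an endomorphism such that the synchronous BRP holds for $(\varphi,L_1,L_2)$. Then $\mathrm{Fix}(\varphi)=\{x\in G\mid x\varphi=x\}$ is isomorphic to an $(L_2\diamond L_2)$-quasiconvex subgroup of $G\times G$, where $L_2\diamond L_2$ is read in $G\times G$ through the homomorphism with $(b,b')\mapsto(b\pi_2,b'\pi_2)$,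 $(b,\$)\mapsto(b\pi_2,1)$ and $(\$,b)\mapsto(1,b\pi_2)$. In particular, $\mathrm{Fix}(\varphi)$ is automatic. -/

import Mathlib

/-- The padded alphabet `(A × B) ∪ (A × {$}) ∪ ({$} × B)`, where `$` is a padding symbol lying
neither in `A` nor in `B`. -/
inductive PadLetter (A B : Type*)
  /-- the letter `(a, b)` -/
  | both (a : A) (b : B)
  /-- the letter `(a, $)` -/
  | left (a : A)
  /-- the letter `($, b)` -/
  | right (b : B)

/-- The convolution `u ⋄ v` of two words: `u` and `v` are read in parallel, the shorter one being
padded with `$` at its end. -/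
def conv {A B : Type*} : List A → List B → List (PadLetter A B)
  | [], v => v.map PadLetter.right
  | a :: u, [] => (a :: u).map PadLetter.left
  | a :: u, b :: v => PadLetter.both a b :: conv u v

/-- The convolution `K ⋄ L = {u ⋄ v | u ∈ K, v ∈ L}` of two languages. -/
def convLanguage {A B : Type*} (K : Language A) (L : Language B) : Language (PadLetter A B) :=
  {w | ∃ u ∈ K, ∃ v ∈ L, w = conv u v}

/-- The element of `G` represented by the word `w`, for a homomorphism `π : A* → G`. -/
def evalWord {A G : Type*} [Group G] (π : FreeMonoid A →* G) (w : List A) : G :=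
  π (FreeMonoid.ofList w)

/-- The homomorphism `C* → G₁ × G₂`, where `C` is the padded alphabet, with
`(a, b) ↦ (π₁ a, π₂ b)`, `(a, $) ↦ (π₁ a, 1)` and `($, b) ↦ (1, π₂ b)`. -/
def convHom {A B G₁ G₂ : Type*} [Group G₁] [Group G₂]
    (π₁ : FreeMonoid A →* G₁) (π₂ : FreeMonoid B →* G₂) :
    FreeMonoid (PadLetter A B) →* G₁ × G₂ :=
  FreeMonoid.lift fun c => match c with
    | PadLetter.both a b => (π₁ (FreeMonoid.of a), π₂ (FreeMonoid.of b))
    | PadLetter.left a => (π₁ (FreeMonoid.of a), 1)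
    | PadLetter.right b => (1, π₂ (FreeMonoid.of b))

/-- The homomorphism `(A ⊔ B)* → G` that restricts to `π₁` on `A*` and to `π₂` on `B*`. -/
def unionHom {A B G : Type*} [Group G] (π₁ : FreeMonoid A →* G) (π₂ : FreeMonoid B →* G) :
    FreeMonoid (A ⊕ B) →* G :=
  FreeMonoid.lift (Sum.elim (fun a => π₁ (FreeMonoid.of a)) (fun b => π₂ (FreeMonoid.of b)))

/-- `L ⊆ A*` is an automatic structure for `π : A* → G`: it is rational, it maps onto `G`
(so `π` is surjective), and for every `x ∈ A ∪ {1}` a finite automaton recognizes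
`{u ⋄ v | u, v ∈ L, v =_G u x}`. -/
structure IsAutomaticStructure {A G : Type*} [Group G] (π : FreeMonoid A →* G)
    (L : Language A) : Prop where
  regular : L.IsRegular
  surjective : ∀ g : G, ∃ w ∈ L, evalWord π w = g
  regular_one : Language.IsRegular
    {w | ∃ u ∈ L, ∃ v ∈ L, evalWord π v = evalWord π u ∧ w = conv u v}
  regular_letter : ∀ a : A, Language.IsRegular
    {w | ∃ u ∈ L, ∃ v ∈ L, evalWord π v = evalWord π u * π (FreeMonoid.of a) ∧ w = conv u v}

/-- A group is automatic if it has an automatic structure over some finite alphabet. -/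
def IsAutomaticGroup (G : Type*) [Group G] : Prop :=
  ∃ (A : Type) (_ : Finite A) (π : FreeMonoid A →* G) (L : Language A), IsAutomaticStructure π L

/-- The metric `d_A` on `G`: the path metric of the Cayley graph of `G` with respect to the images
of the letters of `A`. -/
noncomputable def cayleyDist {A G : Type*} [Group G] (π : FreeMonoid A →* G) (g h : G) : ℕ :=
  (SimpleGraph.mulCayley (Set.range fun a : A => π (FreeMonoid.of a))).dist g h

/-- Synchronous equivalence: `L₁ ∪ L₂` is an automatic structure over the union
of the two alphabets. -/
def SynchronouslyEquivalent {A B G : Type*} [Group G] (π₁ : FreeMonoid A →* G) (L₁ : Language A)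
    (π₂ : FreeMonoid B →* G) (L₂ : Language B) : Prop :=
  IsAutomaticStructure (unionHom π₁ π₂) (Language.map Sum.inl L₁ + Language.map Sum.inr L₂)

/-- The vertex `θ_u^x(n) = x · u^{[n]}` reached after `n` steps by the path that starts in `x` and
is labelled by `u`; it is constant from the end of the word on. -/
def pathAt {A G : Type*} [Group G] (π : FreeMonoid A →* G) (u : List A) (x : G) (n : ℕ) : G :=
  x * evalWord π (u.take n)

/-- The synchronous bounded reduction property for `(φ, L₁, L₂)`. -/
def SynchronousBRP {A B G₁ G₂ : Type*} [Group G₁] [Group G₂] (φ : G₁ →* G₂)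
    (π₁ : FreeMonoid A →* G₁) (L₁ : Language A) (π₂ : FreeMonoid B →* G₂) (L₂ : Language B) :
    Prop :=
  ∃ N : ℕ, 0 < N ∧ ∀ (n : ℕ) (x : G₁), ∀ α ∈ L₁, ∀ β ∈ L₂,
    evalWord π₂ β = φ (evalWord π₁ α) →
      cayleyDist π₂ (φ (pathAt π₁ α x n)) (pathAt π₂ β (φ x) n) ≤ N

/-- `H` is `L`-quasiconvex: every path labelled by a word of `L` with both end points in `H` stays
at bounded distance from `H`. -/
def IsQuasiconvex {A G : Type*} [Group G] (π : FreeMonoid A →* G) (L : Language A)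
    (H : Subgroup G) : Prop :=
  ∃ N : ℕ, ∀ h ∈ H, ∀ h' ∈ H, ∀ w ∈ L, h * evalWord π w = h' →
    ∀ n : ℕ, ∃ k ∈ H, cayleyDist π (h * evalWord π (w.take n)) k ≤ N

/-- The fixed subgroup `Fix(φ) = {x | φ x = x}` of an endomorphism. -/
def fixedSubgroup {G : Type*} [Group G] (φ : G →* G) : Subgroup G :=
  φ.eqLocus (MonoidHom.id G)

/-! Let `u ∈ L₂` represent a fixed point and let `α ∈ L₁` represent the same element. Synchronous
equivalence keeps the prefixes `αₙ` and `uₙ` at bounded distance, and the BRP keeps `φ αₙ` close to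
`uₙ`; so `y = αₙ` has `y⁻¹ * φ y` in a finite set. If `y` and `z` share this value, then `y * z⁻¹`
is fixed. Hence `αₙ`, and with it `uₙ`, stays close to the fixed subgroup
(`exists_finite_take_near_fixedSubgroup`).

The subgroup of `G × G` is the diagonal copy: if `u ⋄ v` joins two of its points, then `u` and `v`
represent the same fixed point and fellow-travel. Automaticity comes from closeness in `G` itself:
rewriting `L₂`-words in Schreier generators yields a regular language that inherits the fellow
traveller property (`IsAutomaticStructure.isAutomaticGroup_subgroup`). -/

open scoped Pointwise

/-! ### Regularity from finitely many left quotients. -/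

namespace Language

/-- A form of the Myhill–Nerode criterion: it suffices to find an invariant of words that takes
finitely many values on the prefixes of words of `L` and that determines their continuations. -/
theorem isRegular_of_invariant {α X : Type*} {L : Language α} (f : List α → X) (S : Set X)
    (hS : S.Finite) (hmem : ∀ w z, w ++ z ∈ L → f w ∈ S)
    (hf : ∀ w z w' z', w ++ z ∈ L → w' ++ z' ∈ L → f w = f w' → w' ++ z ∈ L) :
    L.IsRegular := by
  classical
  apply IsRegular.of_finite_range_leftQuotient
  set T : Set (Language α) := {Q | ∃ w, L.leftQuotient w = Q ∧ ∃ z, w ++ z ∈ L}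
  have hTfin : T.Finite := by
    have hch : ∀ Q : T, ∃ w, L.leftQuotient w = Q ∧ ∃ z, w ++ z ∈ L := fun Q => Q.2
    choose g hg z hz using hch
    have : Finite S := hS
    have hinj : Function.Injective fun Q : T => (⟨f (g Q), hmem _ _ (hz Q)⟩ : S) := by
      intro P Q hPQ
      have h : f (g P) = f (g Q) := congrArg Subtype.val hPQ
      apply Subtype.ext
      rw [← hg P, ← hg Q]
      ext y
      exact ⟨fun hy => hf _ _ _ _ hy (hz Q) h, fun hy => hf _ _ _ _ hy (hz P) h.symm⟩
    exact Finite.of_injective _ hinj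
  -- Words that are not prefixes of words of `L` contribute only the empty quotient.
  refine (hTfin.insert (0 : Language α)).subset ?_
  rintro _ ⟨w, rfl⟩
  by_cases h : ∃ z, w ++ z ∈ L
  · exact Or.inr ⟨w, rfl, h⟩
  · refine Or.inl (Set.eq_empty_iff_forall_notMem.mpr fun z hz => h ⟨z, hz⟩)

end Language

/-! ### Prefixes and factorizations of convolutions. -/

section Convolution

variable {A B : Type*}

/-- The first component of a padded letter, if it is not the padding symbol. -/
def PadLetter.fst? : PadLetter A B → Option A
  | .both a _ => some a
  | .left a => some a
  | .right _ => none

/-- The second component of a padded letter, if it is not the padding symbol. -/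
def PadLetter.snd? : PadLetter A B → Option B
  | .both _ b => some b
  | .left _ => none
  | .right b => some b

@[simp] theorem conv_nil_left (v : List B) :
    conv ([] : List A) v = v.map PadLetter.right := by
  simp [conv]

@[simp] theorem conv_nil_right (u : List A) :
    conv u ([] : List B) = u.map PadLetter.left := by
  cases u <;> simp [conv]

@[simp] theorem conv_cons_cons (a : A) (b : B) (u : List A) (v : List B) :
    conv (a :: u) (b :: v) = PadLetter.both a b :: conv u v := by
  simp [conv]

theorem filterMap_fst_conv (u : List A) (v : List B) :
    (conv u v).filterMap PadLetter.fst? = u := by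
  induction u generalizing v with
  | nil => simp [List.filterMap_map, Function.comp_def, PadLetter.fst?]
  | cons a u ih =>
    cases v with
    | nil => simp [List.filterMap_map, Function.comp_def, PadLetter.fst?]
    | cons b v => simp [PadLetter.fst?, ih]

theorem filterMap_snd_conv (u : List A) (v : List B) :
    (conv u v).filterMap PadLetter.snd? = v := by
  induction u generalizing v with
  | nil => simp [List.filterMap_map, Function.comp_def, PadLetter.snd?]
  | cons a u ih =>
    cases v with
    | nil => simp [PadLetter.snd?]
    | cons b v => simp [PadLetter.snd?, ih]

theorem take_conv (u : List A) (v : List B) (n : ℕ) :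
    (conv u v).take n = conv (u.take n) (v.take n) := by
  induction u generalizing v n with
  | nil => simp
  | cons a u ih =>
    cases v with
    | nil => simp
    | cons b v => cases n <;> simp [ih]

theorem drop_conv (u : List A) (v : List B) (n : ℕ) :
    (conv u v).drop n = conv (u.drop n) (v.drop n) := by
  induction u generalizing v n with
  | nil => simp
  | cons a u ih =>
    cases v with
    | nil => simp
    | cons b v => cases n <;> simp [ih]

/-- Once a component has been padded, no letter may follow in it; this is what `hu` and `hv` say. -/
theorem conv_append_conv (u₁ u₂ : List A) (v₁ v₂ : List B)
    (hu : u₁.length < v₁.length → u₂ = []) (hv : v₁.length < u₁.length → v₂ = []) :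
    conv u₁ v₁ ++ conv u₂ v₂ = conv (u₁ ++ u₂) (v₁ ++ v₂) := by
  induction u₁ generalizing v₁ with
  | nil =>
    cases v₁ with
    | nil => simp
    | cons b v => simp [hu (by simp)]
  | cons a u ih =>
    cases v₁ with
    | nil => simp [hv (by simp)]
    | cons b v =>
      simp only [List.length_cons, Nat.add_lt_add_iff_right] at hu hv
      simp [ih v hu hv]

/-- The ways to split a convolution into two factors. -/
theorem append_eq_conv {w z : List (PadLetter A B)} {u : List A} {v : List B}
    (h : w ++ z = conv u v) :
    ∃ u₁ u₂ v₁ v₂, u = u₁ ++ u₂ ∧ v = v₁ ++ v₂ ∧ w = conv u₁ v₁ ∧ z = conv u₂ v₂ ∧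
      u₁ = u.take w.length ∧ v₁ = v.take w.length ∧
      (u₁.length < v₁.length → u₂ = []) ∧ (v₁.length < u₁.length → v₂ = []) := by
  refine ⟨u.take w.length, u.drop w.length, v.take w.length, v.drop w.length,
    by simp, by simp, ?_, ?_, rfl, rfl, ?_, ?_⟩
  · rw [← take_conv, ← h]; simp
  · rw [← drop_conv, ← h]; simp
  · intro h
    simp only [List.length_take] at h
    exact List.drop_eq_nil_of_le (by omega)
  · intro h
    simp only [List.length_take] at h
    exact List.drop_eq_nil_of_le (by omega)

end Convolution

/-! ### Evaluation of words. -/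

section EvalWord

variable {A B G : Type*} [Group G]

@[simp] theorem evalWord_nil (π : FreeMonoid A →* G) : evalWord π [] = 1 := by
  simp [evalWord]

@[simp] theorem evalWord_cons (π : FreeMonoid A →* G) (a : A) (w : List A) :
    evalWord π (a :: w) = π (FreeMonoid.of a) * evalWord π w := by
  simp [evalWord, FreeMonoid.ofList_cons]

@[simp] theorem evalWord_append (π : FreeMonoid A →* G) (u v : List A) :
    evalWord π (u ++ v) = evalWord π u * evalWord π v := by
  simp [evalWord, FreeMonoid.ofList_append]

@[simp] theorem unionHom_of (π₁ : FreeMonoid A →* G) (π₂ : FreeMonoid B →* G) (c : A ⊕ B) :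
    unionHom π₁ π₂ (FreeMonoid.of c) =
      Sum.elim (fun a => π₁ (FreeMonoid.of a)) (fun b => π₂ (FreeMonoid.of b)) c := by
  simp [unionHom]

theorem evalWord_unionHom_inl (π₁ : FreeMonoid A →* G) (π₂ : FreeMonoid B →* G) (w : List A) :
    evalWord (unionHom π₁ π₂) (w.map Sum.inl) = evalWord π₁ w := by
  induction w with
  | nil => simp
  | cons a w ih => simp [ih]

theorem evalWord_unionHom_inr (π₁ : FreeMonoid A →* G) (π₂ : FreeMonoid B →* G) (w : List B) :
    evalWord (unionHom π₁ π₂) (w.map Sum.inr) = evalWord π₂ w := by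
  induction w with
  | nil => simp
  | cons a w ih => simp [ih]

section

variable {G₁ G₂ : Type*} [Group G₁] [Group G₂] (π₁ : FreeMonoid A →* G₁) (π₂ : FreeMonoid B →* G₂)

@[simp] theorem convHom_of_both (a : A) (b : B) :
    convHom π₁ π₂ (FreeMonoid.of (.both a b)) = (π₁ (FreeMonoid.of a), π₂ (FreeMonoid.of b)) := by
  simp [convHom]

@[simp] theorem convHom_of_left (a : A) :
    convHom π₁ π₂ (FreeMonoid.of (.left a)) = (π₁ (FreeMonoid.of a), 1) := by
  simp [convHom]

@[simp] theorem convHom_of_right (b : B) :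
    convHom π₁ π₂ (FreeMonoid.of (.right b)) = (1, π₂ (FreeMonoid.of b)) := by
  simp [convHom]

theorem evalWord_convHom_map_left (u : List A) :
    evalWord (convHom π₁ π₂) (u.map PadLetter.left) = (evalWord π₁ u, 1) := by
  induction u with
  | nil => simp [Prod.one_eq_mk]
  | cons a u ih => simp [ih]

theorem evalWord_convHom_map_right (v : List B) :
    evalWord (convHom π₁ π₂) (v.map PadLetter.right) = (1, evalWord π₂ v) := by
  induction v with
  | nil => simp [Prod.one_eq_mk]
  | cons a u ih => simp [ih]

theorem evalWord_convHom_conv (u : List A) (v : List B) :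
    evalWord (convHom π₁ π₂) (conv u v) = (evalWord π₁ u, evalWord π₂ v) := by
  induction u generalizing v with
  | nil => simp [evalWord_convHom_map_right]
  | cons a u ih =>
    cases v with
    | nil => simp [evalWord_convHom_map_left]
    | cons b v => simp [ih]

end

end EvalWord

/-! ### Automatic structures and the fellow traveller property. -/

section FellowTraveller

variable {A G : Type*} [Group G]

/-- The differences between simultaneous vertices of two paths from the same vertex that are
labelled by words of `L` and whose end points differ by `x`. -/
def wordDifferences (π : FreeMonoid A →* G) (L : Language A) (x : G) : Set G :=
  {d | ∃ u ∈ L, ∃ v ∈ L, evalWord π v = evalWord π u * x ∧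
    ∃ n : ℕ, d = (evalWord π (u.take n))⁻¹ * evalWord π (v.take n)}

/-- The words `u ⋄ v` with `u, v ∈ L` and `v =_G u x`. -/
def multiplierLanguage (π : FreeMonoid A →* G) (L : Language A) (x : G) :
    Language (PadLetter A A) :=
  {w | ∃ u ∈ L, ∃ v ∈ L, evalWord π v = evalWord π u * x ∧ w = conv u v}

/-- If `u₂ ⋄ v₂` continues `u₁ ⋄ v₁` inside the language, then `u₁⁻¹ v₁ = u₂ x v₂⁻¹`. Any
continuation gives the same value, so the difference depends only on the left quotient. -/
theorem finite_wordDifferences_of_isRegular {π : FreeMonoid A →* G} {L : Language A} {x : G}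
    (h : (multiplierLanguage π L x).IsRegular) : (wordDifferences π L x).Finite := by
  classical
  let F : Language (PadLetter A A) → G := fun Q =>
    if hQ : ∃ z, z ∈ Q then
      evalWord π (hQ.choose.filterMap PadLetter.fst?) * x *
        (evalWord π (hQ.choose.filterMap PadLetter.snd?))⁻¹
    else 1
  refine (h.finite_range_leftQuotient.image F).subset ?_
  rintro _ ⟨u, hu, v, hv, huv, n, rfl⟩
  refine ⟨_, ⟨(conv u v).take n, rfl⟩, ?_⟩
  have hQ : ∃ z, z ∈ (multiplierLanguage π L x).leftQuotient ((conv u v).take n) := by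
    refine ⟨(conv u v).drop n, ?_⟩
    rw [Language.mem_leftQuotient, List.take_append_drop]
    exact ⟨u, hu, v, hv, huv, rfl⟩
  simp only [F, dif_pos hQ]
  obtain ⟨u', -, v', -, huv', hz⟩ := hQ.choose_spec
  generalize hQ.choose = z at hz
  have h1 := congrArg (fun w => evalWord π (w.filterMap PadLetter.fst?)) hz
  have h2 := congrArg (fun w => evalWord π (w.filterMap PadLetter.snd?)) hz
  simp only [take_conv, List.filterMap_append, filterMap_fst_conv, filterMap_snd_conv,
    evalWord_append] at h1 h2
  rw [← h1, ← h2] at huv'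
  rw [eq_inv_mul_iff_mul_eq, ← mul_assoc, mul_inv_eq_iff_eq_mul, huv']
  group

/-- A finite automaton can store the quotients of `L` by both components, which component is already
padded, and the current difference; these determine the continuations. -/
theorem isRegular_multiplierLanguage {π : FreeMonoid A →* G} {L : Language A} {x : G}
    (hL : L.IsRegular) (h : (wordDifferences π L x).Finite) :
    (multiplierLanguage π L x).IsRegular := by
  let p : List (PadLetter A A) → List A := List.filterMap PadLetter.fst?
  let q : List (PadLetter A A) → List A := List.filterMap PadLetter.snd?
  refine Language.isRegular_of_invariant
    (fun w => ((L.leftQuotient (p w), L.leftQuotient (q w)),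
      ((p w).length < (q w).length, (q w).length < (p w).length),
      (evalWord π (p w))⁻¹ * evalWord π (q w)))
    ((Set.range L.leftQuotient ×ˢ Set.range L.leftQuotient) ×ˢ
      ((Set.univ : Set (Prop × Prop)) ×ˢ wordDifferences π L x))
    ((hL.finite_range_leftQuotient.prod hL.finite_range_leftQuotient).prod
      (Set.finite_univ.prod h)) ?_ ?_
  · rintro w z ⟨u, hu, v, hv, huv, hw⟩
    obtain ⟨u₁, u₂, v₁, v₂, rfl, rfl, rfl, rfl, h₁, h₂, -⟩ := append_eq_conv hw
    simp only [p, q, filterMap_fst_conv, filterMap_snd_conv]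
    refine ⟨⟨⟨_, rfl⟩, ⟨_, rfl⟩⟩, trivial, _, hu, _, hv, huv, (conv u₁ v₁).length, ?_⟩
    dsimp only
    rw [← h₁, ← h₂]
  · rintro w z w' z' ⟨u, hu, v, hv, huv, hw⟩ ⟨u', hu', v', hv', huv', hw'⟩ heq
    obtain ⟨u₁, u₂, v₁, v₂, rfl, rfl, rfl, rfl, -, -, h₁, h₂⟩ := append_eq_conv hw
    obtain ⟨s₁, s₂, t₁, t₂, rfl, rfl, rfl, rfl, -, -, -, -⟩ := append_eq_conv hw'
    simp only [p, q, filterMap_fst_conv, filterMap_snd_conv, Prod.mk.injEq] at heq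
    obtain ⟨⟨e₁, e₂⟩, ⟨e₃, e₄⟩, e₅⟩ := heq
    refine ⟨s₁ ++ u₂, ?_, t₁ ++ v₂, ?_, ?_, ?_⟩
    · rw [← Language.mem_leftQuotient, ← e₁]; exact hu
    · rw [← Language.mem_leftQuotient, ← e₂]; exact hv
    · simp only [evalWord_append] at huv ⊢
      rw [inv_mul_eq_iff_eq_mul] at e₅
      rw [e₅] at huv
      simp only [mul_assoc, mul_right_inj] at huv ⊢
      rw [← huv]; group
    · exact conv_append_conv _ _ _ _ (fun h => h₁ (e₃ ▸ h)) (fun h => h₂ (e₄ ▸ h))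

/-- In an automatic structure, the differences along `L`-words representing `g` and `g x` take
finitely many values, for every `x`. -/
theorem IsAutomaticStructure.finite_wordDifferences {π : FreeMonoid A →* G} {L : Language A}
    (h : IsAutomaticStructure π L) (x : G) : (wordDifferences π L x).Finite := by
  have h1 : (wordDifferences π L 1).Finite := by
    apply finite_wordDifferences_of_isRegular
    simpa only [multiplierLanguage, mul_one] using h.regular_one
  obtain ⟨w, -, rfl⟩ := h.surjective x
  induction w with
  | nil => simpa using h1
  | cons a w ih =>
    refine ((finite_wordDifferences_of_isRegular (h.regular_letter a)).mul ih).subset ?_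
    rintro _ ⟨u, hu, v, hv, huv, n, rfl⟩
    -- Inserting an `L`-word `t` for `u a` splits the difference into a product of two.
    obtain ⟨t, ht, hte⟩ := h.surjective (evalWord π u * π (FreeMonoid.of a))
    refine ⟨_, ⟨u, hu, t, ht, hte, n, rfl⟩, _, ⟨t, ht, v, hv, ?_, n, rfl⟩, ?_⟩
    · rw [huv, hte, evalWord_cons, mul_assoc]
    · simp

theorem isAutomaticStructure_of_finite_wordDifferences {π : FreeMonoid A →* G} {L : Language A}
    (hL : L.IsRegular) (hsurj : ∀ g : G, ∃ w ∈ L, evalWord π w = g)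
    (h : ∀ x, (wordDifferences π L x).Finite) : IsAutomaticStructure π L where
  regular := hL
  surjective := hsurj
  regular_one := by
    simpa only [multiplierLanguage, mul_one] using isRegular_multiplierLanguage hL (h 1)
  regular_letter _ := isRegular_multiplierLanguage hL (h _)

end FellowTraveller

/-! ### Bounded distance versus finite sets of differences. -/

section CayleyGraph

variable {A G : Type*} [Group G]

open SimpleGraph in
/-- Pairs of group elements with differences in a finite set are at bounded distance. -/
theorem exists_cayleyDist_le (π : FreeMonoid A →* G) {S : Set G} (hS : S.Finite) :
    ∃ N : ℕ, ∀ g h, g⁻¹ * h ∈ S → cayleyDist π g h ≤ N := by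
  obtain ⟨N, hN⟩ := (hS.image (cayleyDist π 1)).bddAbove
  refine ⟨N, fun g h hgh => le_trans ?_ (hN ⟨_, hgh, rfl⟩)⟩
  by_cases hr : (mulCayley (Set.range fun a : A => π (FreeMonoid.of a))).Reachable 1 (g⁻¹ * h)
  · obtain ⟨p, hp⟩ := hr.exists_walk_length_eq_dist
    let f : mulCayley (Set.range fun a : A => π (FreeMonoid.of a)) →g
        mulCayley (Set.range fun a : A => π (FreeMonoid.of a)) :=
      ⟨fun x => g * x, fun h => mulCayley_adj_mul_iff_right.mpr h⟩
    have h1 : f 1 = g := mul_one g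
    have h2 : f (g⁻¹ * h) = h := mul_inv_cancel_left g h
    have := dist_le ((p.map f).copy h1 h2)
    rw [Walk.length_copy, Walk.length_map, hp] at this
    exact this
  -- Unreachable pairs have `dist` equal to 0, so the bound is trivial.
  · have hr' : ¬ (mulCayley (Set.range fun a : A => π (FreeMonoid.of a))).Reachable g h := by
      intro h'
      apply hr
      let f : mulCayley (Set.range fun a : A => π (FreeMonoid.of a)) →g
          mulCayley (Set.range fun a : A => π (FreeMonoid.of a)) :=
        ⟨fun x => g⁻¹ * x, fun h => mulCayley_adj_mul_iff_right.mpr h⟩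
      simpa [f] using h'.map f
    rw [cayleyDist, dist_eq_zero_of_not_reachable hr']
    exact Nat.zero_le _

open SimpleGraph in
/-- Balls in the Cayley graph of a group with respect to a finite generating set are finite. -/
theorem exists_finite_of_cayleyDist_le [Finite A] {π : FreeMonoid A →* G}
    (hπ : ∀ g : G, ∃ w, evalWord π w = g) (N : ℕ) :
    ∃ S : Set G, S.Finite ∧ ∀ g h, cayleyDist π g h ≤ N → g⁻¹ * h ∈ S := by
  set X : Set G := Set.range fun a : A => π (FreeMonoid.of a)
  have hX : X.Finite := Set.finite_range _
  -- The element 1 makes the powers of `T` increase, so `T ^ N` also covers shorter walks.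
  set T : Set G := insert 1 (X ∪ X⁻¹)
  have hT : T.Finite := (hX.union hX.inv).insert 1
  have hwalk : ∀ {g h : G} (p : (mulCayley X).Walk g h), g⁻¹ * h ∈ T ^ p.length := by
    intro g h p
    induction p with
    | nil => simp
    | @cons a b c hab p ih =>
      rw [Walk.length_cons, pow_succ']
      refine ⟨a⁻¹ * b, ?_, _, ih, by group⟩
      rw [mulCayley_adj] at hab
      rcases hab.2 with h | h
      · exact Or.inr (Or.inl h)
      · exact Or.inr (Or.inr (by simpa using h))
  have hreach : ∀ (w : List A) (g : G), (mulCayley X).Reachable g (g * evalWord π w) := by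
    intro w
    induction w with
    | nil => intro g; simp
    | cons a w ih =>
      intro g
      rw [evalWord_cons, ← mul_assoc]
      refine Reachable.trans ?_ (ih _)
      by_cases h : g = g * π (FreeMonoid.of a)
      · rw [← h]
      · exact Adj.reachable ((mulCayley_adj _ _ _).mpr ⟨h, Or.inl ⟨a, by simp⟩⟩)
  have hTN : (T ^ N).Finite := by
    induction N with
    | zero => simp
    | succ N ih => exact (pow_succ T N) ▸ ih.mul hT
  refine ⟨T ^ N, hTN, fun g h hgh => ?_⟩
  obtain ⟨w, hw⟩ := hπ (g⁻¹ * h)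
  have hr : (mulCayley X).Reachable g h := by simpa [hw] using hreach w g
  obtain ⟨p, hp⟩ := hr.exists_walk_length_eq_dist
  exact Set.pow_subset_pow_right (Set.mem_insert 1 _) (hp ▸ hgh) (hwalk p)

end CayleyGraph

/-! ### Schreier rewriting and automaticity of subgroups. -/

section Subgroup

variable {A C G : Type*} [Group G]

/-- A normalized choice of representatives of the right cosets of a subgroup. -/
theorem Subgroup.exists_rightCoset_rep (F : Subgroup G) :
    ∃ r : G → G, r 1 = 1 ∧ (∀ g, r g * g⁻¹ ∈ F) ∧ ∀ k ∈ F, ∀ g, r (k * g) = r g := by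
  classical
  -- The coset `F` is treated apart, since `out` need not choose 1 there.
  refine ⟨fun g => if g ∈ F then 1 else (Quotient.mk (QuotientGroup.rightRel F) g).out,
    by simp, fun g => ?_, fun k hk g => ?_⟩
  · by_cases h : g ∈ F
    · simp [h]
    · have := Quotient.mk_out (s := QuotientGroup.rightRel F) g
      rw [QuotientGroup.rightRel_apply] at this
      simpa [h] using F.inv_mem this
  · have : Quotient.mk (QuotientGroup.rightRel F) (k * g) = Quotient.mk _ g := by
      rw [Quotient.eq, QuotientGroup.rightRel_apply]
      simpa using hk
    simp only [F.mul_mem_cancel_left hk, this]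

/-- The word `w` over `C`, whose letters carry a group element `ρ c` and a letter `β c`, records the
values of `r` along the path from `g` that is labelled by the letters `β c`. -/
def IsItinerary (π : FreeMonoid A →* G) (r : G → G) (ρ : C → G) (β : C → A) : G → List C → Prop
  | _, [] => True
  | g, c :: w => ρ c = r g ∧ IsItinerary π r ρ β (g * π (FreeMonoid.of (β c))) w

variable {π : FreeMonoid A →* G} {r : G → G} {ρ : C → G} {β : C → A}

theorem isItinerary_append {g : G} {w z : List C} :
    IsItinerary π r ρ β g (w ++ z) ↔
      IsItinerary π r ρ β g w ∧ IsItinerary π r ρ β (g * evalWord π (w.map β)) z := by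
  induction w generalizing g with
  | nil => simp [IsItinerary]
  | cons c w ih => simp [IsItinerary, ih, and_assoc, mul_assoc]

/-- The value `r g` determines the coset `F g`, and right multiplication by letters respects these
cosets. -/
theorem IsItinerary.of_rep_eq {F : Subgroup G} (hrF : ∀ g, r g * g⁻¹ ∈ F)
    (hr : ∀ k ∈ F, ∀ g, r (k * g) = r g) {g g' : G} {w : List C}
    (h : IsItinerary π r ρ β g w) (hg : r g = r g') : IsItinerary π r ρ β g' w := by
  induction w generalizing g g' with
  | nil => trivial
  | cons c w ih =>
    refine ⟨h.1.trans hg, ih h.2 ?_⟩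
    have hk : g' * g⁻¹ ∈ F := by
      have := F.mul_mem (F.inv_mem (hrF g')) (hrF g)
      rw [hg] at this
      simpa [mul_assoc] using this
    have := hr _ hk (g * π (FreeMonoid.of (β c)))
    rw [← this]
    simp [mul_assoc]

theorem exists_isItinerary {R : Set G} (hC : ∀ x ∈ R, ∀ a, ∃ c, ρ c = x ∧ β c = a) (g : G)
    (u : List A) (hu : ∀ n, r (g * evalWord π (u.take n)) ∈ R) :
    ∃ w, IsItinerary π r ρ β g w ∧ w.map β = u := by
  induction u generalizing g with
  | nil => exact ⟨[], trivial, rfl⟩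
  | cons a u ih =>
    obtain ⟨c, hc, rfl⟩ := hC _ (hu 0) a
    obtain ⟨w, hw, rfl⟩ := ih (g * π (FreeMonoid.of (β c))) fun n => by
      simpa [mul_assoc] using hu (n + 1)
    exact ⟨c :: w, ⟨by simpa using hc, hw⟩, rfl⟩

/-- The homomorphism onto a subgroup `F` that maps the letter `c` to the Schreier generator
`ρ c · β c · r (ρ c · β c)⁻¹`. -/
def schreierHom (π : FreeMonoid A →* G) (r : G → G) (ρ : C → G) (β : C → A) {F : Subgroup G}
    (hrF : ∀ g, r g * g⁻¹ ∈ F) : FreeMonoid C →* F :=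
  FreeMonoid.lift fun c => ⟨ρ c * π (FreeMonoid.of (β c)) * (r (ρ c * π (FreeMonoid.of (β c))))⁻¹,
    by simpa using F.inv_mem (hrF (ρ c * π (FreeMonoid.of (β c))))⟩

/-- Along an itinerary the product of Schreier generators telescopes. -/
theorem IsItinerary.evalWord_schreierHom {F : Subgroup G} (hrF : ∀ g, r g * g⁻¹ ∈ F)
    (hr : ∀ k ∈ F, ∀ g, r (k * g) = r g) {g : G} {w : List C} (h : IsItinerary π r ρ β g w) :
    ((evalWord (schreierHom π r ρ β hrF) w : F) : G) =
      r g * evalWord π (w.map β) * (r (g * evalWord π (w.map β)))⁻¹ := by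
  induction w generalizing g with
  | nil => simp
  | cons c w ih =>
    have h1 : r (r g * π (FreeMonoid.of (β c))) = r (g * π (FreeMonoid.of (β c))) := by
      rw [← hr _ (hrF g) (g * _)]
      simp [mul_assoc]
    have h2 : (schreierHom π r ρ β hrF (FreeMonoid.of c) : G) =
        r g * π (FreeMonoid.of (β c)) * (r (g * π (FreeMonoid.of (β c))))⁻¹ := by
      rw [schreierHom, FreeMonoid.lift_eval_of, ← h1, ← h.1]
    rw [evalWord_cons, Subgroup.coe_mul, h2, ih h.2]
    simp [mul_assoc]

/-- A subgroup is automatic if the `L`-paths with end points in it stay close to it. -/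
theorem IsAutomaticStructure.isAutomaticGroup_subgroup [Finite A] {L : Language A}
    (hL : IsAutomaticStructure π L) (F : Subgroup G) {R : Set G} (hR : R.Finite)
    (hF : ∀ u ∈ L, evalWord π u ∈ F → ∀ n, ∃ k ∈ F, k⁻¹ * evalWord π (u.take n) ∈ R) :
    IsAutomaticGroup F := by
  obtain ⟨r, hr1, hrF, hr⟩ := F.exists_rightCoset_rep
  have hrR : ∀ u ∈ L, evalWord π u ∈ F → ∀ n, r (evalWord π (u.take n)) ∈ r '' R := by
    intro u hu huF n
    obtain ⟨k, hk, hkR⟩ := hF u hu huF n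
    exact ⟨_, hkR, hr _ (F.inv_mem hk) _⟩
  have hfin : (r '' R).Finite := hR.image r
  have : Finite (r '' R) := hfin
  -- Encoding by `Fin m` places the alphabet in `Type`, as `IsAutomaticGroup` requires.
  obtain ⟨m, ⟨e⟩⟩ := Finite.exists_equiv_fin ((r '' R) × A)
  let ρ : Fin m → G := fun c => (e.symm c).1
  let β : Fin m → A := fun c => (e.symm c).2
  have hC : ∀ x ∈ r '' R, ∀ a, ∃ c, ρ c = x ∧ β c = a := fun x hx a =>
    ⟨e (⟨x, hx⟩, a), by simp [ρ], by simp [β]⟩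
  let M : Language (Fin m) :=
    {w | IsItinerary π r ρ β 1 w ∧ w.map β ∈ L ∧ evalWord π (w.map β) ∈ F}
  have hrep : ∀ w z, w ++ z ∈ M → r (evalWord π (w.map β)) ∈ r '' R := by
    rintro w z ⟨-, hw, hwF⟩
    simpa using hrR _ hw hwF w.length
  have hM : M.IsRegular := by
    refine Language.isRegular_of_invariant
      (fun w => (L.leftQuotient (w.map β), r (evalWord π (w.map β))))
      (Set.range L.leftQuotient ×ˢ (r '' R))
      (hL.regular.finite_range_leftQuotient.prod hfin)
      (fun w z hw => ⟨⟨_, rfl⟩, hrep w z hw⟩) ?_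
    rintro w z w' z' ⟨hi, hw, hwF⟩ ⟨hi', -, -⟩ heq
    simp only [Prod.mk.injEq] at heq
    rw [isItinerary_append, one_mul] at hi hi'
    rw [List.map_append] at hw hwF
    refine ⟨isItinerary_append.mpr ⟨hi'.1, ?_⟩, ?_, ?_⟩
    · rw [one_mul]; exact hi.2.of_rep_eq hrF hr heq.2
    · rw [List.map_append, ← Language.mem_leftQuotient, ← heq.1]; exact hw
    -- Equal representatives give `w' w⁻¹ ∈ F`, and `w' z = (w' w⁻¹)(w z)`.
    · have hk := F.mul_mem (F.inv_mem (hrF (evalWord π (w'.map β))))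
        (hrF (evalWord π (w.map β)))
      rw [← heq.2] at hk
      have := F.mul_mem hk hwF
      simpa [mul_assoc] using this
  refine ⟨Fin m, inferInstance, schreierHom π r ρ β hrF, M,
    isAutomaticStructure_of_finite_wordDifferences hM ?_ ?_⟩
  · rintro ⟨g, hg⟩
    obtain ⟨u, hu, rfl⟩ := hL.surjective g
    obtain ⟨w, hw, rfl⟩ := exists_isItinerary (π := π) (r := r) hC 1 u
      (by simpa using hrR u hu hg)
    refine ⟨w, ⟨hw, hu, hg⟩, Subtype.ext ?_⟩
    have hrg : r (evalWord π (w.map β)) = 1 := by simpa [hr1] using hr _ hg 1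
    rw [hw.evalWord_schreierHom hrF hr]
    simp [hr1, hrg]
  · intro x
    -- The prefix of `u` evaluates to `uₙ r(uₙ)⁻¹`, so the difference is `r(uₙ) (uₙ⁻¹ vₙ) r(vₙ)⁻¹`.
    refine Set.Finite.subset (((hfin.mul (hL.finite_wordDifferences (x : G))).mul
      hfin.inv).preimage Subtype.val_injective.injOn) ?_
    rintro _ ⟨u, ⟨hui, huL, huF⟩, v, ⟨hvi, hvL, hvF⟩, huv, n, rfl⟩
    have hval : ∀ w : List (Fin m), IsItinerary π r ρ β 1 w → evalWord π (w.map β) ∈ F →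
        ((evalWord (schreierHom π r ρ β hrF) w : F) : G) = evalWord π (w.map β) := by
      intro w hw hwF
      have : r (evalWord π (w.map β)) = 1 := by simpa [hr1] using hr _ hwF 1
      rw [hw.evalWord_schreierHom hrF hr]
      simp [hr1, this]
    have htake : ∀ w : List (Fin m), IsItinerary π r ρ β 1 w →
        ((evalWord (schreierHom π r ρ β hrF) (w.take n) : F) : G) =
          evalWord π ((w.map β).take n) * (r (evalWord π ((w.map β).take n)))⁻¹ := by
      intro w hw
      rw [← List.take_append_drop n w, isItinerary_append] at hw
      rw [hw.1.evalWord_schreierHom hrF hr]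
      simp [hr1, List.map_take]
    have huv' := congrArg (Subtype.val) huv
    rw [Subgroup.coe_mul, hval u hui huF, hval v hvi hvF] at huv'
    rw [Set.mem_preimage, Subgroup.coe_mul, Subgroup.coe_inv, htake u hui, htake v hvi]
    refine ⟨_, ⟨_, hrR _ huL huF n, _, ⟨_, huL, _, hvL, huv', n, rfl⟩, rfl⟩, _,
      Set.inv_mem_inv.mpr (hrR _ hvL hvF n), ?_⟩
    simp [mul_assoc]

end Subgroup

/-! ### Elements moved by a bounded amount. -/

section FixedSubgroup

variable {G : Type*} [Group G]

/-- The elements that an endomorphism moves by a bounded amount are close to its fixed subgroup. -/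
theorem exists_finite_near_fixedSubgroup (φ : G →* G) {T : Set G} (hT : T.Finite) :
    ∃ R : Set G, R.Finite ∧
      ∀ y, y⁻¹ * φ y ∈ T → ∃ k ∈ fixedSubgroup φ, k⁻¹ * y ∈ R := by
  classical
  -- One sample element for each value of `y⁻¹ * φ y`.
  let s : G → G := fun t => if h : ∃ y, y⁻¹ * φ y = t then h.choose else 1
  refine ⟨s '' T, hT.image s, fun y hy => ⟨y * (s (y⁻¹ * φ y))⁻¹, ?_, _, hy, by group⟩⟩
  have hex : ∃ z, z⁻¹ * φ z = y⁻¹ * φ y := ⟨y, rfl⟩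
  have hs : (s (y⁻¹ * φ y))⁻¹ * φ (s (y⁻¹ * φ y)) = y⁻¹ * φ y := by
    simp only [s, dif_pos hex]
    exact hex.choose_spec
  generalize s (y⁻¹ * φ y) = z at hs
  change φ (y * z⁻¹) = y * z⁻¹
  rw [inv_mul_eq_iff_eq_mul] at hs
  rw [map_mul, map_inv, hs]
  group

end FixedSubgroup

/-! ### Paths to fixed points. -/

section SynchronousEquivalence

variable {A B G : Type*} [Group G]

theorem SynchronouslyEquivalent.exists_finite_differences {π₁ : FreeMonoid A →* G}
    {L₁ : Language A} {π₂ : FreeMonoid B →* G} {L₂ : Language B}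
    (h : SynchronouslyEquivalent π₁ L₁ π₂ L₂) :
    ∃ D : Set G, D.Finite ∧ ∀ u ∈ L₁, ∀ v ∈ L₂, evalWord π₂ v = evalWord π₁ u →
      ∀ n, (evalWord π₁ (u.take n))⁻¹ * evalWord π₂ (v.take n) ∈ D := by
  refine ⟨_, IsAutomaticStructure.finite_wordDifferences h 1, fun u hu v hv huv n =>
    ⟨u.map Sum.inl, Or.inl ⟨u, hu, rfl⟩, v.map Sum.inr, Or.inr ⟨v, hv, rfl⟩, ?_, n, ?_⟩⟩
  · rw [evalWord_unionHom_inl, evalWord_unionHom_inr, huv, mul_one]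
  · rw [← List.map_take, ← List.map_take, evalWord_unionHom_inl, evalWord_unionHom_inr]

/-- Paths labelled by `L₂`-words that represent fixed points stay close to the fixed subgroup. -/
theorem exists_finite_take_near_fixedSubgroup [Finite B] {π₁ : FreeMonoid A →* G}
    {L₁ : Language A} {π₂ : FreeMonoid B →* G} {L₂ : Language B}
    (hL₁ : IsAutomaticStructure π₁ L₁) (hL₂ : IsAutomaticStructure π₂ L₂)
    (hequiv : SynchronouslyEquivalent π₁ L₁ π₂ L₂) {φ : G →* G}
    (hφ : SynchronousBRP φ π₁ L₁ π₂ L₂) :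
    ∃ R : Set G, R.Finite ∧ ∀ u ∈ L₂, evalWord π₂ u ∈ fixedSubgroup φ →
      ∀ n, ∃ k ∈ fixedSubgroup φ, k⁻¹ * evalWord π₂ (u.take n) ∈ R := by
  obtain ⟨D, hD, hDmem⟩ := hequiv.exists_finite_differences
  obtain ⟨N, -, hN⟩ := hφ
  obtain ⟨E, hE, hEmem⟩ := exists_finite_of_cayleyDist_le (π := π₂)
    (fun g => (hL₂.surjective g).imp fun _ h => h.2) N
  obtain ⟨R, hR, hRmem⟩ := exists_finite_near_fixedSubgroup φ (hD.mul hE.inv)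
  refine ⟨R * D, hR.mul hD, fun u hu huF n => ?_⟩
  obtain ⟨α, hα, hαu⟩ := hL₁.surjective (evalWord π₂ u)
  have hd := hDmem α hα u hu hαu.symm n
  have hfix : φ (evalWord π₂ u) = evalWord π₂ u := huF
  have he := hEmem _ _ (hN n 1 α hα u hu (by rw [hαu, hfix]))
  simp only [pathAt, map_one, one_mul] at he
  -- Here `αₙ⁻¹ φ(αₙ) = (αₙ⁻¹ uₙ)(φ(αₙ)⁻¹ uₙ)⁻¹`.
  obtain ⟨k, hk, hkR⟩ := hRmem (evalWord π₁ (α.take n))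
    ⟨_, hd, _, Set.inv_mem_inv.mpr he, by group⟩
  exact ⟨k, hk, _, hkR, _, hd, by group⟩

end SynchronousEquivalence

theorem corollary5p7 {G A B : Type*} [Group G] [Finite A] [Finite B]
    (π₁ : FreeMonoid A →* G) (π₂ : FreeMonoid B →* G)
    (L₁ : Language A) (L₂ : Language B)
    (hL₁ : IsAutomaticStructure π₁ L₁) (hL₂ : IsAutomaticStructure π₂ L₂)
    (hequiv : SynchronouslyEquivalent π₁ L₁ π₂ L₂)
    (φ : G →* G) (hφ : SynchronousBRP φ π₁ L₁ π₂ L₂) :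
    (∃ H : Subgroup (G × G),
      IsQuasiconvex (convHom π₂ π₂) (convLanguage L₂ L₂) H ∧
        Nonempty (fixedSubgroup φ ≃* H)) ∧
    IsAutomaticGroup (fixedSubgroup φ) := by
  obtain ⟨R, hR, hRmem⟩ := exists_finite_take_near_fixedSubgroup hL₁ hL₂ hequiv hφ
  refine ⟨⟨(fixedSubgroup φ).map ((MonoidHom.id G).prod (MonoidHom.id G)), ?_, ⟨?_⟩⟩,
    hL₂.isAutomaticGroup_subgroup _ hR hRmem⟩
  · have hD := hL₂.finite_wordDifferences 1
    -- With `k` fixed and close to `uₙ`, the two coordinates are `uₙ⁻¹ k` and `vₙ⁻¹ k = (uₙ⁻¹ vₙ)⁻¹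
    -- (k⁻¹ uₙ)⁻¹`.
    obtain ⟨N, hN⟩ := exists_cayleyDist_le (convHom π₂ π₂) (hR.inv.prod (hD.inv.mul hR.inv))
    refine ⟨N, ?_⟩
    rintro _ ⟨g, hg, rfl⟩ _ ⟨g', hg', rfl⟩ _ ⟨u, hu, v, hv, rfl⟩ hw n
    rw [evalWord_convHom_conv] at hw
    simp only [MonoidHom.prod_apply, MonoidHom.id_apply, Prod.mk_mul_mk, Prod.mk.injEq] at hw
    have huF : evalWord π₂ u ∈ fixedSubgroup φ := by
      rw [← (fixedSubgroup φ).mul_mem_cancel_left hg, hw.1]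
      exact hg'
    have huv : evalWord π₂ v = evalWord π₂ u * 1 := by
      rw [mul_one]
      exact mul_left_cancel (hw.2.trans hw.1.symm)
    obtain ⟨k, hk, hkR⟩ := hRmem u hu huF n
    refine ⟨(g * k, g * k), ⟨g * k, (fixedSubgroup φ).mul_mem hg hk, rfl⟩, hN _ _ ?_⟩
    rw [take_conv, evalWord_convHom_conv]
    have hd : (evalWord π₂ (u.take n))⁻¹ * evalWord π₂ (v.take n) ∈ wordDifferences π₂ L₂ 1 :=
      ⟨u, hu, v, hv, huv, n, rfl⟩
    refine ⟨?_, _, Set.inv_mem_inv.mpr hd, _, Set.inv_mem_inv.mpr hkR, ?_⟩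
    · rw [Set.mem_inv]
      simpa [mul_assoc] using hkR
    · simp [mul_assoc]
  · exact Subgroup.equivMapOfInjective _ _ fun x y h => congrArg Prod.fst h
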